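/- Secure caching model. A server has $N$ independent files $W_1,\dots,W_N$, each uniform on $\{1,\dots,2^F\}$, and serves $K$ users over a shared link that an external wiretapper observes. An $(M,R)$ secure caching scheme for file size $F$ consists of random caching functions $Z_k=\phi_k(W_1,\dots,W_N)$, $k\in[K]$, each taking at most $2^{MF}$ values, random encoding functions $X_d=\psi_d(W_1,\dots,W_N)$, $d\in[N]^K$, each taking at most $2^{RF}$ values (the randomness is common to all the caching and encoding functions, so that it can serve as secret keys, and is independent of the files), and decoding functions $\hat W_{d,k}=\mu_{d,k}(X_d,Z_k)$. Let $P_e=\max_{d,k}\mathbb P(\hat W_{d,k}\ne W_{d_k})$ and $L=\max_d I(X_d;W_1,\dots,W_N)$. The pair $(M,R)$ is securely achievable if for every $\epsilon>0$ and every large enough $F$ there is an $(M,R)$ secure caching scheme with $P_e\le\epsilon$ and $L\le\epsilon$; and $R^*_s(M)=\inf\{R:(M,R)\text{ is securely achievable}\}$. The centralized secure rate $R^C_s(M)$, $1\le M\le N$, is the lower convex envelope of the $K+1$ points $$\left(M_t,\ \frac{K\left(1-\frac{M_t-1}{N-1}\right)}{1+K\,\frac{M_t-1}{N-1}}\right),\qquad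 M_t=\frac{N-1}{K}\,t+1,\quad t=0,1,\dots,K.$$ Theorem. Let $N\ge 2$ and $K\ge 1$, and let $M$ be a real number with $$\max\left\{\frac{(K-N)(N-1)}{KN}+1,\ 1\right\}\le M\le N.$$ Then some rate is securely achievable at $M$. If $M<N$, then $R^*_s(M)>0$ and $$1\le \frac{R^C_s(M)}{R^*_s(M)}\le 17;$$ if $M=N$, then $R^C_s(M)=R^*_s(M)=0$. -/

import Mathlib

open MeasureTheory

namespace SecureCaching

noncomputable section

/-- The contents of the database: `N` files, each an element of a set of size `2 ^ F`. -/
abbrev Files (N F : ℕ) : Type := Fin N → Fin (2 ^ F)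

/-- The request vectors `(d_1, …, d_K)`. -/
abbrev Demand (N K : ℕ) : Type := Fin K → Fin N

/-- The law of the database: the `N` files are independent and uniform on their `2 ^ F` values. -/
def filesLaw (N F : ℕ) : Measure (Files N F) :=
  Measure.pi fun _ : Fin N => ProbabilityTheory.uniformOn (Set.univ : Set (Fin (2 ^ F)))

/-- Mutual information, in bits, of two finitely valued random variables `X` and `Y` under the
probability measure `P`. Terms with `P(X = a, Y = b) = 0` vanish. -/
def mutualInfo {Ω α β : Type*} [MeasurableSpace Ω] [Fintype α] [Fintype β]
    (P : Measure Ω) (X : Ω → α) (Y : Ω → β) : ℝ :=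
  ∑ a : α, ∑ b : β, P.real {ω | X ω = a ∧ Y ω = b} *
    Real.logb 2 (P.real {ω | X ω = a ∧ Y ω = b} / (P.real {ω | X ω = a} * P.real {ω | Y ω = b}))

/-- A secure caching scheme with `N` files of `F` bits, `K` users, cache size `M * F` bits and
transmission size `R * F` bits. The randomness `θ` of the caching and encoding functions is drawn
at the server from an arbitrary probability space, independently of the files; being common to the
caching functions and the encoding functions, it contains the secret keys. An object of size at
most `x` bits is an object that takes at most `2 ^ x` values. -/
structure Scheme (N K F : ℕ) (M R : ℝ) where
  /-- The space of the server's randomness. -/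
  Θ : Type
  /-- Its events. -/
  mΘ : MeasurableSpace Θ
  /-- The law of the server's randomness. -/
  ν : Measure Θ
  /-- It is a probability law. -/
  prob : IsProbabilityMeasure ν
  /-- The random caching functions. -/
  cache : Fin K → Files N F → Θ → Fin ⌊(2 : ℝ) ^ (M * (F : ℝ))⌋₊
  measurable_cache : ∀ k w, Measurable (cache k w)
  /-- The random encoding functions. -/
  encode : Demand N K → Files N F → Θ → Fin ⌊(2 : ℝ) ^ (R * (F : ℝ))⌋₊
  measurable_encode : ∀ d w, Measurable (encode d w)
  /-- The decoding functions. -/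
  decode : Demand N K → Fin K → Fin ⌊(2 : ℝ) ^ (R * (F : ℝ))⌋₊ →
    Fin ⌊(2 : ℝ) ^ (M * (F : ℝ))⌋₊ → Fin (2 ^ F)

namespace Scheme

variable {N K F : ℕ} {M R : ℝ}

instance (S : Scheme N K F M R) : MeasurableSpace S.Θ := S.mΘ

instance (S : Scheme N K F M R) : IsProbabilityMeasure S.ν := S.prob

/-- The joint law of the files and of the server's randomness, which are independent. -/
def law (S : Scheme N K F M R) : Measure (Files N F × S.Θ) := (filesLaw N F).prod S.ν

/-- The cache content `Z_k` of user `k`. -/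
def Z (S : Scheme N K F M R) (k : Fin K) (ω : Files N F × S.Θ) :
    Fin ⌊(2 : ℝ) ^ (M * (F : ℝ))⌋₊ :=
  S.cache k ω.1 ω.2

/-- The transmission `X_d` over the shared link for the request vector `d`. -/
def X (S : Scheme N K F M R) (d : Demand N K) (ω : Files N F × S.Θ) :
    Fin ⌊(2 : ℝ) ^ (R * (F : ℝ))⌋₊ :=
  S.encode d ω.1 ω.2

/-- The probability that user `k` decodes its requested file wrongly, for the requests `d`. -/
def errorProb (S : Scheme N K F M R) (d : Demand N K) (k : Fin K) : ℝ :=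
  S.law.real {ω | S.decode d k (S.X d ω) (S.Z k ω) ≠ ω.1 (d k)}

/-- The information about the files that the wiretapper gets from `X_d`. -/
def leakage (S : Scheme N K F M R) (d : Demand N K) : ℝ :=
  mutualInfo S.law (S.X d) (fun ω => ω.1)

end Scheme

/-- The pair `(M, R)` is securely achievable: for every `ε > 0` and every large enough file size
`F` there is a scheme whose error probability (maximum over requests and users) and whose leakage
(maximum over requests) are at most `ε`. -/
def SecurelyAchievable (N K : ℕ) (M R : ℝ) : Prop :=
  ∀ ε : ℝ, 0 < ε → ∃ F₀ : ℕ, ∀ F : ℕ, F₀ ≤ F → ∃ S : Scheme N K F M R,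
    (∀ d k, S.errorProb d k ≤ ε) ∧ (∀ d, S.leakage d ≤ ε)

/-- The secure memory-rate tradeoff `R*_s(M)`. -/
def optimalRate (N K : ℕ) (M : ℝ) : ℝ := sInf {R : ℝ | SecurelyAchievable N K M R}

/-- The memory `M_t = (N - 1) t / K + 1` of the `t`-th corner point. -/
def cornerMemory (N K t : ℕ) : ℝ := ((N : ℝ) - 1) / K * t + 1

/-- The rate formula `K (1 - (M-1)/(N-1)) / (1 + K (M-1)/(N-1))`, used at the corner points. -/
def rateFormula (N K : ℕ) (M : ℝ) : ℝ :=
  K * (1 - (M - 1) / ((N : ℝ) - 1)) * (1 / (1 + K * ((M - 1) / ((N : ℝ) - 1))))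

/-- The corner points of the centralized scheme, for `t = 0, 1, …, K`. -/
def cornerPoints (N K : ℕ) : Set (ℝ × ℝ) :=
  Set.range fun t : Fin (K + 1) => (cornerMemory N K t, rateFormula N K (cornerMemory N K t))

/-- The centralized secure rate `R^C_s(M)`, for `1 ≤ M ≤ N`: the lower convex envelope of the
corner points. -/
def centralizedRate (N K : ℕ) (M : ℝ) : ℝ :=
  sInf {R : ℝ | (M, R) ∈ convexHull ℝ (cornerPoints N K)}

end

end SecureCaching

/-!
Achievability. Split a file into symbols indexed by a layer `j` and a set `T` of `ℓ j` users, and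
give each symbol to the users of `T`. For each set of `ℓ j + 1` users the server transmits the sum
of the symbols that one of them wants and all the others hold, masked by a key shared by these
users. Everybody decodes without error, and the transmission is independent of the files. Layers
with the same `ℓ j = t` realize the corner point `t`, and mixtures of layers realize the convex hull
by memory sharing.

Converse. From one transmission with negligible leakage, `m` further ones and `l` caches, one
decodes `(m + 1) l` files. So the wiretapper, who sees the first transmission, has a list of about
`2 ^ ((m R + l M) F)` candidates for these files. By the log-sum inequality a list shorter than
`2 ^ ((m + 1) l F)` would be leaked information, hence `l (m + 1 - M) ≤ m R`.

Ratio. For `M = 1 + x (N - 1)`, `0 ≤ x < 1`, `t = ⌊K x⌋` and `B = K / (t + 1)`, the chord from the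
corner point `t` to `(N, 0)` has rate `(1 - x) B` at `M`. For `B > 17` the converse with
`l = ⌊B / 7⌋` and `m + 1 = ⌊N / l⌋` gives at least a seventeenth of it, and for `B ≤ 17` the
converse with `l = 1` does.
-/

namespace SecureCaching

open ProbabilityTheory Filter Topology

section MutualInformation

theorem sub_add_mul_log_le_mul_log_div {p q c : ℝ} (hp : 0 ≤ p) (hq : 0 ≤ q)
    (hpq : q = 0 → p = 0) (hc : 0 < c) :
    p - c * q + p * Real.log c ≤ p * Real.log (p / q) := by
  rcases hp.eq_or_lt with rfl | hp'
  · simpa using mul_nonneg hc.le hq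
  · have hq' : 0 < q := hq.lt_of_ne' (mt hpq hp'.ne')
    have hlog : Real.log (p / (c * q)) = Real.log (p / q) - Real.log c := by
      rw [← Real.log_div (by positivity) hc.ne', div_div, mul_comm]
    have hmul : p * (1 - (p / (c * q))⁻¹) ≤ p * Real.log (p / (c * q)) :=
      mul_le_mul_of_nonneg_left (Real.one_sub_inv_le_log_of_pos (by positivity)) hp
    have hcancel : p * (1 - (p / (c * q))⁻¹) = p - c * q := by field_simp
    rw [hcancel, hlog] at hmul
    linarith

theorem sum_mul_log_sub_le_sum_mul_log_div {α : Type*} [Fintype α] {p q : α → ℝ}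
    (hp : ∀ a, 0 ≤ p a) (hq : ∀ a, 0 ≤ q a) (hpq : ∀ a, q a = 0 → p a = 0)
    (hsum : ∑ a, q a ≤ ∑ a, p a) (A : Finset α) {c : ℝ} (hc : 0 < c) :
    (∑ a ∈ A, p a) * Real.log c - c * ∑ a ∈ A, q a ≤ ∑ a, p a * Real.log (p a / q a) := by
  classical
  have hA : ∑ a ∈ A, (p a - c * q a + p a * Real.log c) ≤ ∑ a ∈ A, p a * Real.log (p a / q a) :=
    Finset.sum_le_sum fun a _ => sub_add_mul_log_le_mul_log_div (hp a) (hq a) (hpq a) hc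
  have hAc : ∑ a ∈ Aᶜ, (p a - q a) ≤ ∑ a ∈ Aᶜ, p a * Real.log (p a / q a) :=
    Finset.sum_le_sum fun a _ => by
      simpa using sub_add_mul_log_le_mul_log_div (hp a) (hq a) (hpq a) one_pos
  have hqA : 0 ≤ ∑ a ∈ A, q a := Finset.sum_nonneg fun a _ => hq a
  rw [← Finset.sum_add_sum_compl A q, ← Finset.sum_add_sum_compl A p] at hsum
  rw [← Finset.sum_add_sum_compl A fun a => p a * Real.log (p a / q a)]
  simp only [Finset.sum_add_distrib, Finset.sum_sub_distrib, ← Finset.mul_sum,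
    ← Finset.sum_mul] at hA hAc
  linarith

theorem sum_measureReal_eq {Ω α : Type*} [MeasurableSpace Ω] {P : Measure Ω} [IsFiniteMeasure P]
    [MeasurableSpace α] [MeasurableSingletonClass α] {X : Ω → α} (hX : Measurable X)
    (B : Finset α) : ∑ a ∈ B, P.real {ω | X ω = a} = P.real {ω | X ω ∈ B} :=
  sum_measureReal_preimage_singleton B fun a _ => hX (measurableSet_singleton a)

variable {Ω α β : Type*} [MeasurableSpace Ω] [Fintype α] [Fintype β] {P : Measure Ω}
  {X : Ω → α} {Y : Ω → β}

theorem mutualInfo_mul_log_two (P : Measure Ω) (X : Ω → α) (Y : Ω → β) :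
    mutualInfo P X Y * Real.log 2 = ∑ v : α × β, P.real {ω | X ω = v.1 ∧ Y ω = v.2} *
      Real.log (P.real {ω | X ω = v.1 ∧ Y ω = v.2} /
        (P.real {ω | X ω = v.1} * P.real {ω | Y ω = v.2})) := by
  have hlog : Real.log 2 ≠ 0 := (Real.log_pos one_lt_two).ne'
  simp only [mutualInfo, Fintype.sum_prod_type, Finset.sum_mul, Real.logb]
  refine Finset.sum_congr rfl fun a _ => Finset.sum_congr rfl fun b _ => ?_
  field_simp

variable [MeasurableSpace α] [MeasurableSingletonClass α]
  [MeasurableSpace β] [MeasurableSingletonClass β]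

theorem mutualInfo_eq_zero_of_indepFun (h : IndepFun X Y P) : mutualInfo P X Y = 0 := by
  refine Finset.sum_eq_zero fun a _ => Finset.sum_eq_zero fun b _ => ?_
  have hprod : P.real {ω | X ω = a ∧ Y ω = b} = P.real {ω | X ω = a} * P.real {ω | Y ω = b} :=
    (congrArg ENNReal.toReal (h.measure_inter_preimage_eq_mul {a} {b} (measurableSet_singleton a)
      (measurableSet_singleton b))).trans ENNReal.toReal_mul
  rw [hprod]
  by_cases h0 : P.real {ω | X ω = a} * P.real {ω | Y ω = b} = 0
  · rw [h0, zero_mul]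
  · rw [div_self h0, Real.logb_one, mul_zero]

/- The event that `Y` lies in the slice of `A` cut out by `X` has mass at most `δ` under the
product of the marginals: apply the log-sum inequality to the joint law and this product. -/
theorem measureReal_mul_log_sub_le_mutualInfo [IsProbabilityMeasure P] (hX : Measurable X)
    (hY : Measurable Y) (A : Set (α × β)) {c δ : ℝ} (hc : 0 < c)
    (hA : ∀ a, P.real {ω | (a, Y ω) ∈ A} ≤ δ) :
    P.real {ω | (X ω, Y ω) ∈ A} * Real.log c - c * δ ≤ mutualInfo P X Y * Real.log 2 := by
  classical
  lift A to Finset (α × β) using A.toFinite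
  simp only [Finset.mem_coe] at hA ⊢
  have hjoint (B : Finset (α × β)) :
      ∑ v ∈ B, P.real {ω | X ω = v.1 ∧ Y ω = v.2} = P.real {ω | (X ω, Y ω) ∈ B} := by
    simpa only [Prod.ext_iff] using sum_measureReal_eq (P := P) (hX.prodMk hY) B
  have hjoint_univ : ∑ v : α × β, P.real {ω | X ω = v.1 ∧ Y ω = v.2} = 1 := by simp [hjoint]
  have hprod (B : Finset (α × β)) : ∑ v ∈ B, P.real {ω | X ω = v.1} * P.real {ω | Y ω = v.2} =
      ∑ a, P.real {ω | X ω = a} * P.real {ω | (a, Y ω) ∈ B} := by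
    have hslice (a : α) : P.real {ω | (a, Y ω) ∈ B} =
        ∑ b, if (a, b) ∈ B then P.real {ω | Y ω = b} else 0 := by
      rw [← Finset.sum_filter, sum_measureReal_eq hY]
      simp
    simp only [hslice, Finset.mul_sum, mul_ite, mul_zero]
    rw [← Fintype.sum_prod_type', ← Finset.sum_filter, Finset.filter_univ_mem]
  have hX_univ : ∑ a, P.real {ω | X ω = a} = 1 := by simp [sum_measureReal_eq hX]
  have hprod_univ : ∑ v : α × β, P.real {ω | X ω = v.1} * P.real {ω | Y ω = v.2} = 1 := by
    simpa [hX_univ] using hprod Finset.univ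
  have hprod_le : ∑ v ∈ A, P.real {ω | X ω = v.1} * P.real {ω | Y ω = v.2} ≤ δ := by
    rw [hprod, ← one_mul δ, ← hX_univ, Finset.sum_mul]
    gcongr with a
    exact hA a
  have habs (v : α × β) (hv : P.real {ω | X ω = v.1} * P.real {ω | Y ω = v.2} = 0) :
      P.real {ω | X ω = v.1 ∧ Y ω = v.2} = 0 := by
    rcases mul_eq_zero.1 hv with h | h
    · exact measureReal_mono_null (fun ω hω => hω.1) h
    · exact measureReal_mono_null (fun ω hω => hω.2) h
  have hlogsum := sum_mul_log_sub_le_sum_mul_log_div (fun _ => measureReal_nonneg)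
    (fun _ => by positivity) habs (hprod_univ.trans hjoint_univ.symm).le A hc
  rw [hjoint, ← mutualInfo_mul_log_two] at hlogsum
  exact (sub_le_sub_left (mul_le_mul_of_nonneg_left hprod_le hc.le) _).trans hlogsum

end MutualInformation

section FilesLaw

theorem pi_real_setOf_forall_mem {ι κ : Type*} [Fintype ι] [Fintype κ] {α : ι → Type*}
    [∀ i, MeasurableSpace (α i)] (μ : ∀ i, Measure (α i)) [∀ i, IsProbabilityMeasure (μ i)]
    {e : κ → ι} (he : Function.Injective e) {s : ∀ k, Set (α (e k))}
    (hs : ∀ k, MeasurableSet (s k)) :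
    (Measure.pi μ).real {x | ∀ k, x (e k) ∈ s k} = ∏ k, (μ (e k)).real (s k) := by
  have hindep : iIndepFun (fun k (x : ∀ i, α i) => x (e k)) (Measure.pi μ) :=
    (iIndepFun_pi (X := fun _ => id) fun _ => aemeasurable_id).precomp he
  have hinter := hindep.meas_iInter fun k => ⟨s k, hs k, rfl⟩
  simp only [measureReal_def, ← ENNReal.toReal_prod]
  rw [Set.ofPred_forall]
  refine congrArg ENNReal.toReal (hinter.trans (Finset.prod_congr rfl fun k _ => ?_))
  exact (measurePreserving_eval μ (e k)).measure_preimage (hs k).nullMeasurableSet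

theorem uniformOn_univ_real_singleton {α : Type*} [Fintype α] [MeasurableSpace α]
    [MeasurableSingletonClass α] (a : α) :
    (uniformOn (Set.univ : Set α)).real {a} = (Fintype.card α : ℝ)⁻¹ := by
  simp [measureReal_def, uniformOn_univ]

theorem isProbabilityMeasure_uniformOn_univ {α : Type*} [Finite α] [Nonempty α]
    [MeasurableSpace α] [MeasurableSingletonClass α] :
    IsProbabilityMeasure (uniformOn (Set.univ : Set α)) :=
  isProbabilityMeasure_uniformOn Set.finite_univ Set.univ_nonempty

attribute [local instance] isProbabilityMeasure_uniformOn_univ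

variable {N F : ℕ} {ι : Type*} [Fintype ι] {e : ι → Fin N}

instance : IsProbabilityMeasure (filesLaw N F) := by
  unfold filesLaw
  infer_instance

theorem filesLaw_real_forall_eq (he : Function.Injective e) (v : ι → Fin (2 ^ F)) :
    (filesLaw N F).real {w | ∀ i, w (e i) = v i} = (((2 : ℝ) ^ F)⁻¹) ^ Fintype.card ι := by
  refine (pi_real_setOf_forall_mem (fun _ : Fin N => uniformOn (Set.univ : Set (Fin (2 ^ F)))) he
    fun i => measurableSet_singleton (v i)).trans ?_
  simp [uniformOn_univ_real_singleton]

theorem filesLaw_real_exists_forall_eq_le {γ : Type*} [Fintype γ] (he : Function.Injective e)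
    (v : γ → ι → Fin (2 ^ F)) :
    (filesLaw N F).real {w | ∃ y, ∀ i, w (e i) = v y i} ≤
      Fintype.card γ * (((2 : ℝ) ^ F)⁻¹) ^ Fintype.card ι := by
  rw [Set.ofPred_exists]
  refine (measureReal_iUnion_fintype_le _).trans ?_
  simp [filesLaw_real_forall_eq he]

end FilesLaw

section Converse

namespace Scheme

variable {N K F : ℕ} {M R : ℝ} (S : Scheme N K F M R)

instance : IsProbabilityMeasure S.law := by
  unfold law
  infer_instance

theorem measurable_X (d : Demand N K) : Measurable (S.X d) :=
  measurable_from_prod_countable_right fun w => S.measurable_encode d w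

theorem law_real_fst_mem (A : Set (Files N F)) :
    S.law.real {ω | ω.1 ∈ A} = (filesLaw N F).real A :=
  congrArg ENNReal.toReal <| (measurePreserving_fst (μ := filesLaw N F) (ν := S.ν)).measure_preimage
    A.toFinite.measurableSet.nullMeasurableSet

theorem one_sub_le_law_real_forall_decode_eq {ι : Type*} [Fintype ι] (d : ι → Demand N K)
    (k : ι → Fin K) {ε : ℝ} (herr : ∀ i, S.errorProb (d i) (k i) ≤ ε) :
    1 - Fintype.card ι * ε ≤ S.law.real
      {ω | ∀ i, S.decode (d i) (k i) (S.X (d i) ω) (S.Z (k i) ω) = ω.1 (d i (k i))} := by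
  set good := {ω | ∀ i, S.decode (d i) (k i) (S.X (d i) ω) (S.Z (k i) ω) = ω.1 (d i (k i))}
  have hbad : S.law.real goodᶜ ≤ Fintype.card ι * ε := by
    have hcompl : goodᶜ =
        ⋃ i, {ω | S.decode (d i) (k i) (S.X (d i) ω) (S.Z (k i) ω) ≠ ω.1 (d i (k i))} := by
      ext ω
      simp [good]
    calc S.law.real goodᶜ ≤ ∑ i, S.errorProb (d i) (k i) :=
          hcompl ▸ measureReal_iUnion_fintype_le _
      _ ≤ ∑ _ : ι, ε := Finset.sum_le_sum fun i _ => herr i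
      _ = Fintype.card ι * ε := by simp
  have hone : 1 ≤ S.law.real good + S.law.real goodᶜ := by
    simpa using measureReal_union_le (μ := S.law) good goodᶜ
  linarith

/- Given the transmission for `d none`, the other transmissions and the caches take few values, and
each of them determines all the files indexed by `Option κ × U` up to a decoding error. A short
list of candidates for these files would thus be known to the wiretapper. -/
theorem one_sub_mul_log_sub_le_leakage {κ U : Type*} [Fintype κ] [Fintype U]
    {e : Option κ × U → Fin N} (he : Function.Injective e) (d : Option κ → Demand N K)
    (u : U → Fin K) (hd : ∀ i j, d i (u j) = e (i, j)) {ε c : ℝ}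
    (herr : ∀ i j, S.errorProb (d i) (u j) ≤ ε) (hc : 1 ≤ c) :
    (1 - Fintype.card (Option κ × U) * ε) * Real.log c
        - c * ((⌊(2 : ℝ) ^ (R * F)⌋₊ ^ Fintype.card κ * ⌊(2 : ℝ) ^ (M * F)⌋₊ ^ Fintype.card U) *
          (((2 : ℝ) ^ F)⁻¹) ^ Fintype.card (Option κ × U))
      ≤ S.leakage (d none) * Real.log 2 := by
  classical
  let guess (x : Fin ⌊(2 : ℝ) ^ (R * F)⌋₊)
      (y : (κ → Fin ⌊(2 : ℝ) ^ (R * F)⌋₊) × (U → Fin ⌊(2 : ℝ) ^ (M * F)⌋₊))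
      (p : Option κ × U) : Fin (2 ^ F) :=
    S.decode (d p.1) (u p.2) (p.1.elim x y.1) (y.2 p.2)
  let A : Set (Fin ⌊(2 : ℝ) ^ (R * F)⌋₊ × Files N F) :=
    {v | ∃ y, ∀ p, v.2 (e p) = guess v.1 y p}
  have hslice (x) : S.law.real {ω | (x, ω.1) ∈ A} ≤
      (⌊(2 : ℝ) ^ (R * F)⌋₊ ^ Fintype.card κ * ⌊(2 : ℝ) ^ (M * F)⌋₊ ^ Fintype.card U) *
        (((2 : ℝ) ^ F)⁻¹) ^ Fintype.card (Option κ × U) := by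
    refine (S.law_real_fst_mem {w | (x, w) ∈ A}).trans_le ?_
    refine (filesLaw_real_exists_forall_eq_le he (guess x)).trans_eq ?_
    simp
  have hdecoded : 1 - Fintype.card (Option κ × U) * ε ≤
      S.law.real {ω | (S.X (d none) ω, ω.1) ∈ A} := by
    refine (S.one_sub_le_law_real_forall_decode_eq (fun p : Option κ × U => d p.1)
      (fun p => u p.2) fun p => herr p.1 p.2).trans (measureReal_mono fun ω hω => ?_)
    refine ⟨(fun i => S.X (d (some i)) ω, fun j => S.Z (u j) ω), fun ⟨i, j⟩ => ?_⟩
    rw [← hd]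
    refine (hω (i, j)).symm.trans ?_
    cases i <;> rfl
  refine le_trans (sub_le_sub_right ?_ _) <| measureReal_mul_log_sub_le_mutualInfo
    (S.measurable_X (d none)) measurable_fst A (one_pos.trans_le hc) hslice
  exact mul_le_mul_of_nonneg_right hdecoded (Real.log_nonneg hc)

end Scheme

theorem floor_two_rpow_pow_mul_le (M R : ℝ) (F m l n : ℕ) :
    (⌊(2 : ℝ) ^ (R * F)⌋₊ ^ m * ⌊(2 : ℝ) ^ (M * F)⌋₊ ^ l) * (((2 : ℝ) ^ F)⁻¹) ^ n ≤
      ((2 : ℝ) ^ (m * R + l * M - n)) ^ F := by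
  calc (⌊(2 : ℝ) ^ (R * F)⌋₊ ^ m * ⌊(2 : ℝ) ^ (M * F)⌋₊ ^ l) * (((2 : ℝ) ^ F)⁻¹) ^ n
      ≤ (((2 : ℝ) ^ (R * F)) ^ m * ((2 : ℝ) ^ (M * F)) ^ l) * (((2 : ℝ) ^ F)⁻¹) ^ n := by
        gcongr <;> exact Nat.floor_le (by positivity)
    _ = ((2 : ℝ) ^ (m * R + l * M - n)) ^ F := by
        simp only [← Real.rpow_natCast, ← Real.rpow_neg zero_le_two, ← Real.rpow_mul zero_le_two,
          ← Real.rpow_add two_pos]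
        congr 1
        ring

variable {N K : ℕ} {M R : ℝ}

theorem SecurelyAchievable.mul_sub_le_mul (h : SecurelyAchievable N K M R) {l m : ℕ} (hl : 1 ≤ l)
    (hlK : l ≤ K) (hlm : (m + 1) * l ≤ N) : l * (m + 1 - M) ≤ m * R := by
  by_contra! hlt
  have hexp : m * R + l * M - ((m + 1) * l : ℕ) < 0 := by
    push_cast
    linarith
  have htend : Tendsto
      (fun F : ℕ => Real.exp 3 * ((2 : ℝ) ^ (m * R + l * M - ((m + 1) * l : ℕ))) ^ F)
      atTop (𝓝 0) := by
    simpa using (tendsto_pow_atTop_nhds_zero_of_lt_one (by positivity)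
      (Real.rpow_lt_one_of_one_lt_of_neg one_lt_two hexp)).const_mul (Real.exp 3)
  obtain ⟨F₀, hF₀⟩ := h (1 / (2 * ((m + 1) * l : ℕ))) (by positivity)
  obtain ⟨F, hF, hsmall⟩ :=
    ((eventually_ge_atTop F₀).and (htend.eventually_lt_const one_pos)).exists
  obtain ⟨S, herr, hleak⟩ := hF₀ F hF
  obtain ⟨e⟩ : Nonempty (Option (Fin m) × Fin l ↪ Fin N) :=
    Function.Embedding.nonempty_of_card_le (by simpa using hlm)
  let d (i : Option (Fin m)) : Demand N K :=
    Function.extend (Fin.castLE hlK) (fun j => e (i, j)) fun _ => e (none, ⟨0, hl⟩)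
  have hconv := S.one_sub_mul_log_sub_le_leakage e.injective d (Fin.castLE hlK)
    (fun i j => (Fin.castLE_injective hlK).extend_apply _ _ j) (fun i j => herr _ _)
    (Real.one_le_exp (by norm_num : (0 : ℝ) ≤ 3))
  have hcard : Fintype.card (Option (Fin m) × Fin l) = (m + 1) * l := by simp
  rw [hcard, Real.log_exp, Fintype.card_fin, Fintype.card_fin] at hconv
  have hlist := (mul_le_mul_of_nonneg_left (floor_two_rpow_pow_mul_le M R F m l ((m + 1) * l))
    (Real.exp_pos 3).le).trans_lt hsmall
  have hpos : (1 : ℝ) ≤ ((m + 1) * l : ℕ) := by exact_mod_cast Nat.mul_pos m.succ_pos hl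
  have hhalf : (((m + 1) * l : ℕ) : ℝ) * (1 / (2 * ((m + 1) * l : ℕ))) = 1 / 2 := by field_simp
  have hleak' : S.leakage (d none) * Real.log 2 ≤ 1 / 2 * 1 := by
    have hε : 1 / (2 * (((m + 1) * l : ℕ) : ℝ)) ≤ 1 / 2 :=
      one_div_le_one_div_of_le two_pos (by linarith)
    exact mul_le_mul ((hleak _).trans hε) (by linarith [Real.log_two_lt_d9])
      (Real.log_nonneg one_le_two) (by norm_num)
  rw [hhalf] at hconv
  linarith

theorem SecurelyAchievable.sub_le_mul (h : SecurelyAchievable N K M R) (hN : 1 ≤ N) (hK : 1 ≤ K) :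
    N - M ≤ (N - 1) * R := by
  obtain ⟨n, rfl⟩ := Nat.exists_eq_add_one.2 hN
  simpa using h.mul_sub_le_mul (m := n) le_rfl hK (mul_one _).le

end Converse

section OneTimePad

attribute [local instance] isProbabilityMeasure_uniformOn_univ

theorem isAddLeftInvariant_uniformOn_univ {G : Type*} [AddGroup G] [MeasurableSpace G]
    [MeasurableAdd G] : (uniformOn (Set.univ : Set G)).IsAddLeftInvariant := by
  rw [uniformOn, ProbabilityTheory.cond, Measure.restrict_univ]
  infer_instance

theorem indepFun_add_fst {α G : Type*} [MeasurableSpace α] [AddGroup G] [MeasurableSpace G]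
    [MeasurableAdd₂ G] (μ : Measure α) [IsProbabilityMeasure μ] (ν : Measure G)
    [IsProbabilityMeasure ν] [ν.IsAddLeftInvariant] {g : α → G} (hg : Measurable g) :
    IndepFun (fun ω : α × G => g ω.1 + ω.2) Prod.fst (μ.prod ν) := by
  have hsum : Measurable fun ω : α × G => g ω.1 + ω.2 :=
    (hg.comp measurable_fst).add measurable_snd
  have hpres : MeasurePreserving (fun ω : α × G => (ω.1, g ω.1 + ω.2)) (μ.prod ν) (μ.prod ν) :=
    (MeasurePreserving.id μ).skew_product hsum (ae_of_all _ fun a => map_add_left_eq_self ν (g a))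
  have hmap : (μ.prod ν).map (fun ω : α × G => g ω.1 + ω.2) = ν :=
    (measurePreserving_snd.comp hpres).map_eq
  refine IndepFun.symm <| (indepFun_iff_map_prod_eq_prod_map_map measurable_fst.aemeasurable
    hsum.aemeasurable).2 ?_
  rw [hmap, measurePreserving_fst.map_eq]
  exact hpres.map_eq

variable {N K F : ℕ} {M R : ℝ}

/-- A scheme without decoding errors or leakage. The achievability proof constructs only such
schemes. -/
def Scheme.IsPerfect (S : Scheme N K F M R) : Prop :=
  (∀ d k, S.errorProb d k = 0) ∧ ∀ d, S.leakage d = 0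

theorem securelyAchievable_of_eventually_isPerfect
    (h : ∀ᶠ F in atTop, ∃ S : Scheme N K F M R, S.IsPerfect) : SecurelyAchievable N K M R := by
  intro ε hε
  obtain ⟨F₀, hF₀⟩ := eventually_atTop.1 h
  refine ⟨F₀, fun F hF => ?_⟩
  obtain ⟨S, herr, hleak⟩ := hF₀ F hF
  exact ⟨S, fun d k => (herr d k).trans_le hε.le, fun d => (hleak d).trans_le hε.le⟩

/-- A caching code protected by a one-time pad: the server transmits a message masked by the sum
with a key in `G`, and user `k` keeps an element of `C k` that depends on the files and the key. The
sizes of `G` and of `C k` are not constrained yet. -/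
structure PaddedCode (N K F : ℕ) (G : Type) [AddGroup G] (C : Fin K → Type) where
  /-- The caching functions. -/
  cache : ∀ k, Files N F → G → C k
  /-- The message before masking. -/
  message : Demand N K → Files N F → G
  /-- The decoding functions. -/
  decode : Demand N K → ∀ k, G → C k → Fin (2 ^ F)
  decode_eq : ∀ d k w s, decode d k (message d w + s) (cache k w s) = w (d k)

namespace PaddedCode

variable {G : Type} [AddGroup G] [Finite G] [MeasurableSpace G] [DiscreteMeasurableSpace G]
  {C : Fin K → Type} (c : PaddedCode N K F G C) (ι : G ↪ Fin ⌊(2 : ℝ) ^ (R * (F : ℝ))⌋₊)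
  (κ : ∀ k, C k ↪ Fin ⌊(2 : ℝ) ^ (M * (F : ℝ))⌋₊)

/-- The scheme that draws the key uniformly and numbers the transmissions and the cache contents
through `ι` and `κ`. -/
noncomputable def toScheme : Scheme N K F M R where
  Θ := G
  mΘ := inferInstance
  ν := uniformOn Set.univ
  prob := inferInstance
  cache k w s := κ k (c.cache k w s)
  measurable_cache _ _ := .of_discrete
  encode d w s := ι (c.message d w + s)
  measurable_encode _ _ := .of_discrete
  decode d k x z := Function.extend (Prod.map ι (κ k)) (Function.uncurry (c.decode d k)) 0 (x, z)

theorem isPerfect_toScheme : (c.toScheme ι κ).IsPerfect := by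
  refine ⟨fun d k => ?_, fun d => mutualInfo_eq_zero_of_indepFun ?_⟩
  · have hdecode (ω : Files N F × G) : (c.toScheme ι κ).decode d k
        ((c.toScheme ι κ).X d ω) ((c.toScheme ι κ).Z k ω) = ω.1 (d k) :=
      ((ι.injective.prodMap (κ k).injective).extend_apply (Function.uncurry (c.decode d k)) 0
        (c.message d ω.1 + ω.2, c.cache k ω.1 ω.2)).trans (c.decode_eq d k ω.1 ω.2)
    have hempty : {ω : Files N F × G | (c.toScheme ι κ).decode d k
        ((c.toScheme ι κ).X d ω) ((c.toScheme ι κ).Z k ω) ≠ ω.1 (d k)} = ∅ := by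
      simp [hdecode]
    exact (congrArg (c.toScheme ι κ).law.real hempty).trans measureReal_empty
  · have := isAddLeftInvariant_uniformOn_univ (G := G)
    exact (indepFun_add_fst (filesLaw N F) (uniformOn (Set.univ : Set G))
      (Measurable.of_discrete (f := c.message d))).comp (φ := ι) .of_discrete measurable_id

end PaddedCode

end OneTimePad

section CodedPlacement

variable {J A : Type} {K : ℕ} {ℓ : J → ℕ}

/-- The indices of symbols placed in layers: the symbol at `(j, T)` of layer `j` belongs to a set
`T` of `ℓ j` users. The file symbols are indexed with `ℓ`, the key symbols with `ℓ + 1`. -/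
abbrev LayerIndex (K : ℕ) (ℓ : J → ℕ) : Type := {q : J × Finset (Fin K) // q.2.card = ℓ q.1}

/-- The indices of the symbols that belong to user `k`. -/
abbrev HeldIndex (ℓ : J → ℕ) (k : Fin K) : Type :=
  {q : J × Finset (Fin K) // q.2.card = ℓ q.1 ∧ k ∈ q.2}

/-- The symbols of `x` that belong to user `k`. -/
def held (k : Fin K) (x : LayerIndex K ℓ → A) (q : HeldIndex ℓ k) : A := x ⟨q.1, q.2.1⟩

/-- Extension by zero of a function on a subtype. It makes symbols with computed indices, such as
`(j, T.erase i)`, available without a proof that the index is valid. -/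
noncomputable def zeroExtend {B : Type*} {P : B → Prop} [Zero A] (x : {b // P b} → A) : B → A :=
  Function.extend Subtype.val x (0 : B → A)

theorem zeroExtend_val {B : Type*} {P : B → Prop} [Zero A] (x : {b // P b} → A) (b : {b // P b}) :
    zeroExtend x b = x b :=
  Subtype.val_injective.extend_apply x (0 : B → A) b

theorem zeroExtend_of_not {B : Type*} {P : B → Prop} [Zero A] (x : {b // P b} → A) {b : B}
    (hb : ¬P b) : zeroExtend x b = 0 :=
  Function.extend_apply' x (0 : B → A) b fun ⟨a, ha⟩ => hb (ha ▸ a.2)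

theorem zeroExtend_held [Zero A] {k : Fin K} (x : LayerIndex K ℓ → A) {q : J × Finset (Fin K)}
    (hk : k ∈ q.2) : zeroExtend (held k x) q = zeroExtend x q := by
  by_cases hq : q.2.card = ℓ q.1
  · exact (zeroExtend_val (held k x) ⟨q, hq, hk⟩).trans (zeroExtend_val x ⟨q, hq⟩).symm
  · rw [zeroExtend_of_not x hq, zeroExtend_of_not (held k x) fun h => hq h.1]

variable [AddCommGroup A]

/-- The message of coded delivery when user `i` requests the file with symbols `x i`: for each set
`T` of `ℓ j + 1` users, the sum over `i ∈ T` of the symbol wanted by `i` and held by all others. -/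
noncomputable def codedMessage (x : Fin K → LayerIndex K ℓ → A) :
    LayerIndex K (fun j => ℓ j + 1) → A :=
  fun q => ∑ i ∈ q.1.2, zeroExtend (x i) (q.1.1, q.1.2.erase i)

/-- The decoder of user `k` for coded delivery, from the masked message `y`, the keys `s` that it
holds, and the symbols `z i` that it holds of the file requested by user `i`. -/
noncomputable def recover (k : Fin K) (y : LayerIndex K (fun j => ℓ j + 1) → A)
    (s : HeldIndex (fun j => ℓ j + 1) k → A) (z : Fin K → HeldIndex ℓ k → A) :
    LayerIndex K ℓ → A := fun ⟨(j, T), _⟩ =>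
  if k ∈ T then zeroExtend (z k) (j, T)
  else zeroExtend y (j, insert k T) - zeroExtend s (j, insert k T)
    - ∑ i ∈ T, zeroExtend (z i) (j, (insert k T).erase i)

theorem recover_codedMessage_add (k : Fin K) (x : Fin K → LayerIndex K ℓ → A)
    (s : LayerIndex K (fun j => ℓ j + 1) → A) :
    recover k (codedMessage x + s) (held k s) (fun i => held k (x i)) = x k := by
  funext ⟨(j, T), hT⟩
  by_cases hk : k ∈ T
  · simp only [recover, if_pos hk]
    rw [zeroExtend_held _ hk, zeroExtend_val (x k) ⟨(j, T), hT⟩]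
  · have hsum : ∑ i ∈ T, zeroExtend (held k (x i)) (j, (insert k T).erase i) =
        ∑ i ∈ T, zeroExtend (x i) (j, (insert k T).erase i) :=
      Finset.sum_congr rfl fun i hi => zeroExtend_held _ <|
        Finset.mem_erase.2 ⟨fun h => hk (h ▸ hi), Finset.mem_insert_self k T⟩
    have hmask : zeroExtend (codedMessage x + s) (j, insert k T) =
        ∑ i ∈ insert k T, zeroExtend (x i) (j, (insert k T).erase i)
          + zeroExtend s (j, insert k T) := by
      let q : LayerIndex K fun j => ℓ j + 1 :=
        ⟨(j, insert k T), by rw [Finset.card_insert_of_notMem hk, hT]⟩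
      exact (zeroExtend_val _ q).trans (congrArg (codedMessage x q + ·) (zeroExtend_val s q).symm)
    simp only [recover, if_neg hk]
    rw [hsum, hmask, zeroExtend_held _ (Finset.mem_insert_self k T), Finset.sum_insert hk,
      Finset.erase_insert hk, zeroExtend_val (x k) ⟨(j, T), hT⟩]
    abel

/-- Coded placement and delivery with one-time padded transmissions: `φ` splits a file into symbols,
and each user holds its share of the symbols of all the files and of the key. -/
noncomputable def codedPlacement {N F : ℕ} (φ : Fin (2 ^ F) ↪ (LayerIndex K ℓ → A)) :
    PaddedCode N K F (LayerIndex K (fun j => ℓ j + 1) → A)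
      (fun k => (Fin N × HeldIndex ℓ k ⊕ HeldIndex (fun j => ℓ j + 1) k) → A) where
  cache k w s := Sum.elim (fun p => held k (φ (w p.1)) p.2) (held k s)
  message d w := codedMessage fun i => φ (w (d i))
  decode d k y c := Function.invFun φ <|
    recover k y (fun q => c (.inr q)) fun i q => c (.inl (d i, q))
  decode_eq d k w s := by
    refine (congrArg (Function.invFun φ) ?_).trans (Function.leftInverse_invFun φ.injective _)
    exact recover_codedMessage_add k (fun i => φ (w (d i))) s

end CodedPlacement

section LayerCounting

variable {J : Type} [Fintype J] {K : ℕ}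

theorem card_subtype_prod_eq_sum {α β : Type*} [Fintype α] [Fintype β] (P : α → β → Prop)
    [∀ a, DecidablePred (P a)] :
    Fintype.card {q : α × β // P q.1 q.2} = ∑ a, Fintype.card {b // P a b} :=
  (Fintype.card_congr (Equiv.subtypeProdEquivSigmaSubtype P)).trans Fintype.card_sigma

theorem card_layerIndex (ℓ : J → ℕ) :
    Fintype.card (LayerIndex K ℓ) = ∑ j, K.choose (ℓ j) := by
  simp [card_subtype_prod_eq_sum fun j (T : Finset (Fin K)) => T.card = ℓ j]

theorem mul_card_subtype_card_eq_and_mem (t : ℕ) (k : Fin K) :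
    K * Fintype.card {T : Finset (Fin K) // T.card = t ∧ k ∈ T} = t * K.choose t := by
  obtain ⟨n, rfl⟩ : ∃ n, K = n + 1 := Nat.exists_eq_add_one.2 k.pos
  cases t with
  | zero => simp +contextual [isEmpty_subtype]
  | succ t =>
    have hcard : Fintype.card {T : Finset (Fin (n + 1)) // T.card = t + 1 ∧ k ∈ T} =
        n.choose t := by
      have hfilter := Finset.card_filter_powersetCard_subset {k} Finset.univ (t + 1)
        (Finset.subset_univ _) (by simp)
      rw [Finset.powersetCard_eq_filter, Finset.powerset_univ, Finset.filter_filter] at hfilter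
      simpa [Fintype.card_subtype] using hfilter
    rw [hcard, Nat.add_one_mul_choose_eq, mul_comm]

theorem mul_card_heldIndex (ℓ : J → ℕ) (k : Fin K) :
    K * Fintype.card (HeldIndex ℓ k) = ∑ j, ℓ j * K.choose (ℓ j) := by
  rw [card_subtype_prod_eq_sum fun j (T : Finset (Fin K)) => T.card = ℓ j ∧ k ∈ T, Finset.mul_sum]
  simp only [mul_card_subtype_card_eq_and_mem]

theorem cast_choose_succ_mul (K t : ℕ) :
    (K.choose (t + 1) : ℝ) * (t + 1) = K.choose t * (K - t) := by
  rcases le_or_gt t K with ht | ht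
  · rw [← Nat.cast_sub ht]
    exact_mod_cast Nat.choose_succ_right_eq K t
  · simp [Nat.choose_eq_zero_of_lt ht, Nat.choose_eq_zero_of_lt (ht.trans t.lt_succ_self)]

theorem cast_choose_succ (K t : ℕ) :
    (K.choose (t + 1) : ℝ) = K.choose t * ((K - t) / (t + 1)) := by
  rw [← mul_div_assoc, eq_div_iff (by positivity), cast_choose_succ_mul]

theorem mul_card_heldIndex_add_card_heldIndex (N : ℕ) (ℓ : J → ℕ) (k : Fin K) :
    (N * Fintype.card (HeldIndex ℓ k) + Fintype.card (HeldIndex (fun j => ℓ j + 1) k) : ℝ) =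
      ∑ j, K.choose (ℓ j) * cornerMemory N K (ℓ j) := by
  have hK : (K : ℝ) ≠ 0 := by exact_mod_cast k.pos.ne'
  have hfile : (K : ℝ) * Fintype.card (HeldIndex ℓ k) = ∑ j, (ℓ j : ℝ) * K.choose (ℓ j) := by
    exact_mod_cast mul_card_heldIndex ℓ k
  have hkey : (K : ℝ) * Fintype.card (HeldIndex (fun j => ℓ j + 1) k) =
      ∑ j, ((ℓ j : ℝ) + 1) * K.choose (ℓ j + 1) := by
    exact_mod_cast mul_card_heldIndex (fun j => ℓ j + 1) k
  refine mul_left_cancel₀ hK ?_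
  rw [mul_add, hkey, mul_left_comm, hfile, Finset.mul_sum, Finset.mul_sum,
    ← Finset.sum_add_distrib]
  refine Finset.sum_congr rfl fun j _ => ?_
  rw [mul_comm _ (K.choose (ℓ j + 1) : ℝ), cast_choose_succ_mul, cornerMemory]
  field_simp
  ring

theorem two_pow_le_floor_two_rpow {n : ℕ} {x : ℝ} (h : (n : ℝ) ≤ x) : 2 ^ n ≤ ⌊(2 : ℝ) ^ x⌋₊ := by
  refine Nat.le_floor ?_
  rw [Nat.cast_pow, Nat.cast_two, ← Real.rpow_natCast]
  exact Real.rpow_le_rpow_of_exponent_le one_le_two h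

theorem nonempty_embedding_fin_floor_two_rpow {α : Type*} [Fintype α] {x : ℝ}
    (h : (Fintype.card α : ℝ) ≤ x) : Nonempty ((α → ZMod 2) ↪ Fin ⌊(2 : ℝ) ^ x⌋₊) := by
  classical
  refine Function.Embedding.nonempty_of_card_le ?_
  simpa using two_pow_le_floor_two_rpow h

theorem exists_isPerfect_of_layers {N F : ℕ} {M R : ℝ} (ℓ : J → ℕ)
    (hF : (F : ℝ) ≤ ∑ j, (K.choose (ℓ j) : ℝ))
    (hM : ∑ j, K.choose (ℓ j) * cornerMemory N K (ℓ j) ≤ M * F)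
    (hR : ∑ j, K.choose (ℓ j) * (((K : ℝ) - ℓ j) / (ℓ j + 1)) ≤ R * F) :
    ∃ S : Scheme N K F M R, S.IsPerfect := by
  classical
  obtain ⟨φ⟩ : Nonempty (Fin (2 ^ F) ↪ (LayerIndex K ℓ → ZMod 2)) := by
    have hcard : F ≤ Fintype.card (LayerIndex K ℓ) := by
      rw [card_layerIndex]
      exact_mod_cast hF
    refine Function.Embedding.nonempty_of_card_le ?_
    simpa using Nat.pow_le_pow_right two_pos hcard
  have hkey : (Fintype.card (LayerIndex K fun j => ℓ j + 1) : ℝ) ≤ R * F := by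
    rw [card_layerIndex]
    simpa [cast_choose_succ] using hR
  have hcache (k : Fin K) : (Fintype.card
      (Fin N × HeldIndex ℓ k ⊕ HeldIndex (fun j => ℓ j + 1) k) : ℝ) ≤ M * F := by
    rw [Fintype.card_sum, Fintype.card_prod, Fintype.card_fin, Nat.cast_add, Nat.cast_mul,
      mul_card_heldIndex_add_card_heldIndex]
    exact hM
  obtain ⟨ι⟩ := nonempty_embedding_fin_floor_two_rpow hkey
  exact ⟨_, (codedPlacement φ).isPerfect_toScheme ι fun k =>
    (nonempty_embedding_fin_floor_two_rpow (hcache k)).some⟩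

end LayerCounting

section MemorySharing

variable {N K : ℕ} {M R : ℝ}

theorem exists_isPerfect_of_multiplicities {F : ℕ} (b : Fin (K + 1) → ℕ)
    (hF : (F : ℝ) ≤ ∑ t, (b t * K.choose t : ℝ))
    (hM : ∑ t, b t * (K.choose t * cornerMemory N K t) ≤ M * F)
    (hR : ∑ t, b t * (K.choose t * (((K : ℝ) - (t : ℕ)) / ((t : ℕ) + 1))) ≤ R * F) :
    ∃ S : Scheme N K F M R, S.IsPerfect :=
  exists_isPerfect_of_layers (fun j : Σ t : Fin (K + 1), Fin (b t) => (j.1 : ℕ))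
    (by simpa [Fintype.sum_sigma] using hF) (by simpa [Fintype.sum_sigma] using hM)
    (by simpa [Fintype.sum_sigma] using hR)

theorem securelyAchievable_cornerMemory_of_choose_eq_one (N : ℕ) {t : ℕ} (ht : K.choose t = 1) :
    SecurelyAchievable N K (cornerMemory N K t) ((K - t) / (t + 1)) :=
  securelyAchievable_of_eventually_isPerfect <| .of_forall fun F =>
    exists_isPerfect_of_layers (fun _ : Fin F => t) (by simp [ht]) (by simp [ht, mul_comm])
      (by simp [ht, mul_comm])

theorem eventually_sum_ceil_mul_le {ι : Type*} [Fintype ι] {a r : ι → ℝ} (ha : ∀ i, 0 ≤ a i)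
    {c : ℝ} (h : ∑ i, a i * r i < c) :
    ∀ᶠ F : ℕ in atTop, ∑ i, ⌈a i * F⌉₊ * r i ≤ c * F := by
  have htend : Tendsto (fun F : ℕ => ∑ i, (⌈a i * F⌉₊ / F : ℝ) * r i) atTop
      (𝓝 (∑ i, a i * r i)) :=
    tendsto_finsetSum _ fun i _ => ((tendsto_nat_ceil_mul_div_atTop (ha i)).comp
      tendsto_natCast_atTop_atTop).mul_const (r i)
  filter_upwards [htend.eventually_lt_const h, eventually_gt_atTop 0] with F hF hpos
  have hF0 : (0 : ℝ) < F := by exact_mod_cast hpos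
  rw [← div_le_iff₀ hF0, Finset.sum_div]
  simpa only [div_mul_eq_mul_div] using hF.le

theorem securelyAchievable_of_mem_stdSimplex {w : Fin (K + 1) → ℝ}
    (hw : w ∈ stdSimplex ℝ (Fin (K + 1))) (hM : ∑ t, w t * cornerMemory N K t < M)
    (hR : ∑ t, w t * (((K : ℝ) - (t : ℕ)) / ((t : ℕ) + 1)) < R) : SecurelyAchievable N K M R := by
  have hchoose (t : Fin (K + 1)) : (0 : ℝ) < K.choose t := by
    exact_mod_cast Nat.choose_pos (Nat.lt_succ_iff.1 t.2)
  have hweight (t : Fin (K + 1)) : 0 ≤ w t / K.choose t := div_nonneg (hw.1 t) (hchoose t).le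
  have hshare (r : Fin (K + 1) → ℝ) :
      ∑ t, w t / K.choose t * (K.choose t * r t) = ∑ t, w t * r t :=
    Finset.sum_congr rfl fun t _ => by rw [← mul_assoc, div_mul_cancel₀ _ (hchoose t).ne']
  refine securelyAchievable_of_eventually_isPerfect ?_
  filter_upwards [eventually_sum_ceil_mul_le hweight ((hshare _).trans_lt hM),
    eventually_sum_ceil_mul_le hweight ((hshare _).trans_lt hR)] with F hMF hRF
  refine exists_isPerfect_of_multiplicities (fun t => ⌈w t / K.choose t * F⌉₊) ?_ hMF hRF
  calc (F : ℝ) = ∑ t, w t / K.choose t * F * K.choose t := by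
        simp only [mul_right_comm _ (F : ℝ), div_mul_cancel₀ _ (hchoose _).ne', ← Finset.sum_mul,
          hw.2, one_mul]
    _ ≤ ∑ t, (⌈w t / K.choose t * F⌉₊ * K.choose t : ℝ) :=
        Finset.sum_le_sum fun t _ => mul_le_mul_of_nonneg_right (Nat.le_ceil _) (hchoose t).le

end MemorySharing

section Envelope

variable {N K : ℕ} {M R : ℝ}

theorem rateFormula_cornerMemory (hN : 2 ≤ N) (hK : 1 ≤ K) (t : ℕ) :
    rateFormula N K (cornerMemory N K t) = ((K : ℝ) - t) / (t + 1) := by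
  have hN1 : (N : ℝ) - 1 ≠ 0 := sub_ne_zero.2 (by exact_mod_cast (show N ≠ 1 by lia))
  have hK0 : (K : ℝ) ≠ 0 := by exact_mod_cast (show K ≠ 0 by lia)
  have hmemory : (cornerMemory N K t - 1) / ((N : ℝ) - 1) = t / K := by
    rw [cornerMemory]
    field_simp
    ring
  rw [rateFormula, hmemory]
  field_simp
  ring

theorem cornerPoints_eq_range (hN : 2 ≤ N) (hK : 1 ≤ K) : cornerPoints N K =
    Set.range fun t : Fin (K + 1) =>
      (cornerMemory N K t, ((K : ℝ) - (t : ℕ)) / ((t : ℕ) + 1)) := by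
  simp only [cornerPoints, rateFormula_cornerMemory hN hK]

theorem mem_convexHull_cornerPoints_of_le (hN : 2 ≤ N) (hK : 1 ≤ K) {t : ℕ} (ht : t ≤ K) :
    (cornerMemory N K t, ((K : ℝ) - t) / (t + 1)) ∈ convexHull ℝ (cornerPoints N K) :=
  subset_convexHull ℝ _ <| cornerPoints_eq_range hN hK ▸ ⟨⟨t, Nat.lt_succ_of_le ht⟩, rfl⟩

theorem cornerMemory_zero (N K : ℕ) : cornerMemory N K 0 = 1 := by simp [cornerMemory]

theorem one_mem_convexHull_cornerPoints (hN : 2 ≤ N) (hK : 1 ≤ K) :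
    ((1 : ℝ), (K : ℝ)) ∈ convexHull ℝ (cornerPoints N K) := by
  simpa [cornerMemory_zero] using mem_convexHull_cornerPoints_of_le hN hK K.zero_le

theorem self_mem_convexHull_cornerPoints (hN : 2 ≤ N) (hK : 1 ≤ K) :
    ((N : ℝ), (0 : ℝ)) ∈ convexHull ℝ (cornerPoints N K) := by
  have hmemory : cornerMemory N K K = N := by
    have : (K : ℝ) ≠ 0 := by exact_mod_cast (show K ≠ 0 by lia)
    rw [cornerMemory, div_mul_cancel₀ _ this, sub_add_cancel]
  simpa [hmemory] using mem_convexHull_cornerPoints_of_le hN hK (le_refl K)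

theorem le_mul_add_of_mem_convexHull_cornerPoints (hN : 2 ≤ N) (hK : 1 ≤ K) {a c : ℝ}
    (hc : ∀ t ≤ K, c ≤ a * cornerMemory N K t + (K - t) / (t + 1))
    (h : (M, R) ∈ convexHull ℝ (cornerPoints N K)) : c ≤ a * M + R := by
  refine convexHull_min (t := {v : ℝ × ℝ | c ≤ a * v.1 + v.2}) ?_
    (convex_halfSpace_ge (a • LinearMap.fst ℝ ℝ ℝ + LinearMap.snd ℝ ℝ ℝ).isLinear c) h
  rw [cornerPoints_eq_range hN hK]
  rintro _ ⟨t, rfl⟩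
  exact hc t (Nat.lt_succ_iff.1 t.2)

theorem cornerRate_nonneg {t : ℕ} (ht : t ≤ K) : 0 ≤ ((K : ℝ) - t) / (t + 1) :=
  div_nonneg (sub_nonneg.2 (by exact_mod_cast ht)) (by positivity)

theorem nonneg_of_mem_convexHull_cornerPoints (hN : 2 ≤ N) (hK : 1 ≤ K)
    (h : (M, R) ∈ convexHull ℝ (cornerPoints N K)) : 0 ≤ R := by
  simpa using le_mul_add_of_mem_convexHull_cornerPoints (a := 0) hN hK
    (fun t ht => by simpa using cornerRate_nonneg ht) h

/- The line of slope `-K ^ 2 / (N - 1)` through `(1, K)` stays below all the corner points. -/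
theorem le_of_one_mem_convexHull_cornerPoints (hN : 2 ≤ N) (hK : 1 ≤ K)
    (h : ((1 : ℝ), R) ∈ convexHull ℝ (cornerPoints N K)) : (K : ℝ) ≤ R := by
  have hN1 : (N : ℝ) - 1 ≠ 0 := sub_ne_zero.2 (by exact_mod_cast (show N ≠ 1 by lia))
  have hK1 : (1 : ℝ) ≤ K := by exact_mod_cast hK
  have hline := le_mul_add_of_mem_convexHull_cornerPoints
    (a := (K : ℝ) ^ 2 / (N - 1)) (c := K ^ 2 / (N - 1) + K) hN hK (fun t ht => ?_) h
  · simpa using hline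
  have hslope : (K : ℝ) ^ 2 / (N - 1) * cornerMemory N K t = K ^ 2 / (N - 1) + K * t := by
    rw [cornerMemory]
    field_simp
    ring
  rw [hslope, add_assoc, add_le_add_iff_left]
  rcases t.eq_zero_or_pos with rfl | hpos
  · simp
  · have ht1 : (1 : ℝ) ≤ t := by exact_mod_cast hpos
    exact (le_mul_of_one_le_right (by linarith) ht1).trans
      (le_add_of_nonneg_right (cornerRate_nonneg ht))

theorem exists_mem_stdSimplex_of_mem_convexHull_range {ι E : Type*} [Fintype ι] [AddCommGroup E]
    [Module ℝ E] {v : ι → E} {x : E} (hx : x ∈ convexHull ℝ (Set.range v)) :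
    ∃ w ∈ stdSimplex ℝ ι, ∑ i, w i • v i = x := by
  classical
  refine convexHull_min (t := Fintype.linearCombination ℝ v '' stdSimplex ℝ ι) ?_
    ((convex_stdSimplex ℝ ι).linear_image _) hx
  rintro _ ⟨i, rfl⟩
  exact ⟨Pi.single i 1, single_mem_stdSimplex ℝ i, by simp⟩

theorem securelyAchievable_of_mem_convexHull_cornerPoints {M' R' : ℝ} (hN : 2 ≤ N) (hK : 1 ≤ K)
    (h : (M', R') ∈ convexHull ℝ (cornerPoints N K)) (hM : M' < M) (hR : R' < R) :
    SecurelyAchievable N K M R := by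
  rw [cornerPoints_eq_range hN hK] at h
  obtain ⟨w, hw, hsum⟩ := exists_mem_stdSimplex_of_mem_convexHull_range h
  rw [Prod.ext_iff, Prod.fst_sum, Prod.snd_sum] at hsum
  exact securelyAchievable_of_mem_stdSimplex hw (hsum.1.trans_lt hM) (hsum.2.trans_lt hR)

theorem securelyAchievable_one (N K : ℕ) : SecurelyAchievable N K 1 K := by
  simpa [cornerMemory_zero] using
    securelyAchievable_cornerMemory_of_choose_eq_one N (K := K) (Nat.choose_zero_right K)

theorem exists_securelyAchievable (hN : 2 ≤ N) (hK : 1 ≤ K) (hM : 1 ≤ M) :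
    ∃ R, SecurelyAchievable N K M R := by
  rcases hM.eq_or_lt with rfl | hM
  · exact ⟨K, securelyAchievable_one N K⟩
  · exact ⟨K + 1, securelyAchievable_of_mem_convexHull_cornerPoints hN hK
      (one_mem_convexHull_cornerPoints hN hK) hM (lt_add_one _)⟩

theorem bddBelow_setOf_securelyAchievable (hN : 2 ≤ N) (hK : 1 ≤ K) (M : ℝ) :
    BddBelow {R : ℝ | SecurelyAchievable N K M R} := by
  have hN1 : (0 : ℝ) < N - 1 := sub_pos.2 (by exact_mod_cast hN)
  exact ⟨(N - M) / (N - 1), fun R h =>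
    (div_le_iff₀' hN1).2 (SecurelyAchievable.sub_le_mul h (by lia) hK)⟩

theorem bddBelow_setOf_mem_convexHull_cornerPoints (hN : 2 ≤ N) (hK : 1 ≤ K) (M : ℝ) :
    BddBelow {R : ℝ | (M, R) ∈ convexHull ℝ (cornerPoints N K)} :=
  ⟨0, fun _ h => nonneg_of_mem_convexHull_cornerPoints hN hK h⟩

/- Memory sharing needs some slack in the memory. For `M > 1` it comes from moving slightly towards
the corner point `(1, K)`. -/
theorem optimalRate_le_of_mem_convexHull_cornerPoints (hN : 2 ≤ N) (hK : 1 ≤ K) (hM : 1 ≤ M)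
    (h : (M, R) ∈ convexHull ℝ (cornerPoints N K)) : optimalRate N K M ≤ R := by
  rcases hM.eq_or_lt with rfl | hM
  · exact (csInf_le (bddBelow_setOf_securelyAchievable hN hK 1) (securelyAchievable_one N K)).trans
      (le_of_one_mem_convexHull_cornerPoints hN hK h)
  refine le_of_forall_pos_le_add fun δ hδ =>
    csInf_le (bddBelow_setOf_securelyAchievable hN hK M) ?_
  have hK0 : (0 : ℝ) < K := by exact_mod_cast hK
  have hR : 0 ≤ R := nonneg_of_mem_convexHull_cornerPoints hN hK h
  set η : ℝ := δ / (K + δ)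
  have hη : 0 < η := by positivity
  have hη1 : η < 1 := (div_lt_one (by positivity)).2 (by linarith)
  have hηK : η * K < δ := by
    rw [div_mul_eq_mul_div, div_lt_iff₀ (by positivity)]
    nlinarith
  refine securelyAchievable_of_mem_convexHull_cornerPoints hN hK (convex_convexHull ℝ _ h
    (one_mem_convexHull_cornerPoints hN hK) (sub_nonneg.2 hη1.le) hη.le (sub_add_cancel 1 η)) ?_ ?_
  · change (1 - η) * M + η * 1 < M
    nlinarith
  · change (1 - η) * R + η * K < R + δ
    nlinarith

theorem chord_mem_convexHull_cornerPoints (hN : 2 ≤ N) (hK : 1 ≤ K) {t : ℕ} {x : ℝ} (htK : t < K)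
    (htx : t ≤ K * x) (hx : x ≤ 1) :
    (1 + x * (N - 1), (1 - x) * (K / (t + 1))) ∈ convexHull ℝ (cornerPoints N K) := by
  have hK0 : (0 : ℝ) < K := by exact_mod_cast hK
  have htK' : (0 : ℝ) < K - t := sub_pos.2 (by exact_mod_cast htK)
  convert convex_convexHull ℝ _ (mem_convexHull_cornerPoints_of_le hN hK htK.le)
    (self_mem_convexHull_cornerPoints hN hK)
    (a := K * (1 - x) / (K - t)) (b := (K * x - t) / (K - t))
    (div_nonneg (mul_nonneg hK0.le (sub_nonneg.2 hx)) htK'.le)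
    (div_nonneg (sub_nonneg.2 htx) htK'.le) (by field_simp; ring) using 1
  ext <;> simp only [cornerMemory, Prod.smul_mk, Prod.mk_add_mk, smul_eq_mul] <;> field_simp <;>
    ring

end Envelope

section Ratio

variable {N K : ℕ} {M R : ℝ}

theorem exists_eq_one_add_mul_sub_one (hN : 2 ≤ N) (hM : 1 ≤ M) (hMN : M ≤ N) :
    ∃ x : ℝ, 0 ≤ x ∧ x ≤ 1 ∧ M = 1 + x * (N - 1) := by
  have hN1 : (0 : ℝ) < N - 1 := sub_pos.2 (by exact_mod_cast hN)
  refine ⟨(M - 1) / (N - 1), div_nonneg (sub_nonneg.2 hM) hN1.le,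
    (div_le_one hN1).2 (by linarith), ?_⟩
  rw [div_mul_cancel₀ _ hN1.ne']
  ring

theorem optimalRate_le_centralizedRate (hN : 2 ≤ N) (hK : 1 ≤ K) (hM : 1 ≤ M) (hMN : M ≤ N) :
    optimalRate N K M ≤ centralizedRate N K M := by
  obtain ⟨x, hx0, hx1, rfl⟩ := exists_eq_one_add_mul_sub_one hN hM hMN
  have hchord := chord_mem_convexHull_cornerPoints (t := 0) hN hK hK
    (by simpa using mul_nonneg K.cast_nonneg hx0) hx1
  exact le_csInf ⟨_, hchord⟩ fun R h =>
    optimalRate_le_of_mem_convexHull_cornerPoints hN hK hM h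

theorem sub_div_le_optimalRate (hN : 2 ≤ N) (hK : 1 ≤ K) (hM : 1 ≤ M) :
    (N - M) / (N - 1) ≤ optimalRate N K M := by
  have hN1 : (0 : ℝ) < N - 1 := sub_pos.2 (by exact_mod_cast hN)
  exact le_csInf (exists_securelyAchievable hN hK hM) fun R h =>
    (div_le_iff₀' hN1).2 (SecurelyAchievable.sub_le_mul h (by lia) hK)

theorem optimalRate_pos (hN : 2 ≤ N) (hK : 1 ≤ K) (hM : 1 ≤ M) (hMN : M < N) :
    0 < optimalRate N K M :=
  (div_pos (sub_pos.2 hMN) (sub_pos.2 (by exact_mod_cast hN))).trans_le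
    (sub_div_le_optimalRate hN hK hM)

theorem centralizedRate_self (hN : 2 ≤ N) (hK : 1 ≤ K) : centralizedRate N K N = 0 :=
  IsLeast.csInf_eq ⟨self_mem_convexHull_cornerPoints hN hK,
    fun _ h => nonneg_of_mem_convexHull_cornerPoints hN hK h⟩

theorem optimalRate_self (hN : 2 ≤ N) (hK : 1 ≤ K) : optimalRate N K N = 0 := by
  have hN1 : (1 : ℝ) ≤ N := by exact_mod_cast (one_le_two.trans hN)
  refine le_antisymm (optimalRate_le_of_mem_convexHull_cornerPoints hN hK hN1
    (self_mem_convexHull_cornerPoints hN hK)) ?_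
  simpa using sub_div_le_optimalRate hN hK hN1

theorem SecurelyAchievable.two_thirds_mul_le {x : ℝ}
    (h : SecurelyAchievable N K (1 + x * (N - 1)) R) {l : ℕ} (hl : 1 ≤ l) (hlK : l ≤ K)
    (hlN : 7 * l ≤ 2 * N) (hxl : 7 * (x * l) ≤ 1) : 2 / 3 * l ≤ R := by
  obtain ⟨m, hm⟩ : ∃ m, N / l = m + 1 :=
    Nat.exists_eq_add_one.2 (Nat.div_pos (by lia) hl)
  have hcut := h.mul_sub_le_mul hl hlK (hm ▸ Nat.div_mul_le_self N l)
  have hNl : (N : ℝ) + 1 ≤ (m + 2) * l := by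
    have hlt := Nat.lt_mul_div_succ N hl
    rw [hm, mul_comm] at hlt
    exact_mod_cast hlt
  have hl1 : (1 : ℝ) ≤ l := by exact_mod_cast hl
  have hlN' : 7 * (l : ℝ) ≤ 2 * N := by exact_mod_cast hlN
  have hmemory : 3 * (x * (N - 1)) ≤ m := by
    refine le_of_mul_le_mul_right ?_ (one_pos.trans_le hl1)
    nlinarith
  have hm0 : (0 : ℝ) < m := by
    refine pos_of_mul_pos_left (b := (l : ℝ)) ?_ (by linarith)
    linarith
  refine le_of_mul_le_mul_left ?_ hm0
  nlinarith

theorem SecurelyAchievable.one_sub_mul_div_seventeen_le (hN : 2 ≤ N) (hK : 1 ≤ K) {x B : ℝ}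
    (h : SecurelyAchievable N K (1 + x * (N - 1)) R) (hx0 : 0 ≤ x) (hx1 : x ≤ 1)
    (hBK : B ≤ K) (hBN : B ≤ 2 * N) (hxB : x * B ≤ 1) : (1 - x) * B / 17 ≤ R := by
  rcases le_or_gt B 17 with hB | hB
  · have hN1 : (0 : ℝ) < N - 1 := sub_pos.2 (by exact_mod_cast hN)
    have hsingle : 1 - x ≤ R := by
      refine le_of_mul_le_mul_left ?_ hN1
      linarith [h.sub_le_mul (by lia) hK]
    nlinarith
  · obtain ⟨l, hl, hlB, hBl⟩ : ∃ l : ℕ, 1 ≤ l ∧ 7 * l ≤ B ∧ 2 * B ≤ 21 * l := by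
      refine ⟨⌊B / 7⌋₊, Nat.le_floor (by push_cast; linarith), ?_, ?_⟩
      · linarith [Nat.floor_le (show 0 ≤ B / 7 by linarith)]
      · have htwo : (2 : ℝ) ≤ ⌊B / 7⌋₊ := by
          exact_mod_cast (Nat.le_floor (by push_cast; linarith) : 2 ≤ ⌊B / 7⌋₊)
        linarith [Nat.lt_floor_add_one (B / 7)]
    have hlK : l ≤ K := by exact_mod_cast (show (l : ℝ) ≤ K by linarith)
    have hlN : 7 * l ≤ 2 * N := by exact_mod_cast hlB.trans hBN
    have hR := h.two_thirds_mul_le hl hlK hlN (by nlinarith)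
    nlinarith

theorem centralizedRate_le_seventeen_mul_optimalRate (hN : 2 ≤ N) (hK : 1 ≤ K) {x : ℝ}
    (hx0 : 0 ≤ x) (hx1 : x < 1) (hKx : K ≤ N * (1 + K * x)) :
    centralizedRate N K (1 + x * (N - 1)) ≤ 17 * optimalRate N K (1 + x * (N - 1)) := by
  have hK0 : (0 : ℝ) < K := by exact_mod_cast hK
  have hN1 : (0 : ℝ) ≤ N - 1 := sub_nonneg.2 (by exact_mod_cast (one_le_two.trans hN))
  set t := ⌊K * x⌋₊
  have htx : (t : ℝ) ≤ K * x := Nat.floor_le (by positivity)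
  have hxt : K * x < t + 1 := Nat.lt_floor_add_one _
  have htK : t < K := by exact_mod_cast htx.trans_lt (mul_lt_of_lt_one_right hK0 hx1)
  have hupper : centralizedRate N K (1 + x * (N - 1)) ≤ (1 - x) * (K / (t + 1)) :=
    csInf_le (bddBelow_setOf_mem_convexHull_cornerPoints hN hK _)
      (chord_mem_convexHull_cornerPoints hN hK htK htx hx1.le)
  have hBK : (K : ℝ) / (t + 1) ≤ K := div_le_self hK0.le (by simp)
  have hBN : (K : ℝ) / (t + 1) ≤ 2 * N := by
    rw [div_le_iff₀ (by positivity)]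
    nlinarith [mul_le_mul_of_nonneg_left hxt.le (N.cast_nonneg (α := ℝ)),
      mul_nonneg (N.cast_nonneg (α := ℝ)) (t.cast_nonneg (α := ℝ))]
  have hxB : x * (K / (t + 1)) ≤ 1 := by
    rw [← mul_div_assoc, div_le_one (by positivity)]
    linarith
  have hlower : (1 - x) * (K / (t + 1)) / 17 ≤ optimalRate N K (1 + x * (N - 1)) :=
    le_csInf (exists_securelyAchievable hN hK (le_add_of_nonneg_right (mul_nonneg hx0 hN1)))
      fun R h => SecurelyAchievable.one_sub_mul_div_seventeen_le hN hK h hx0 hx1.le hBK hBN hxB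
  linarith

theorem le_mul_one_add_mul_of_div_add_one_le (hN : 2 ≤ N) (hK : 1 ≤ K) {x : ℝ}
    (h : (K - N) * (N - 1) / (K * N) + 1 ≤ 1 + x * ((N : ℝ) - 1)) : K ≤ N * (1 + K * x) := by
  have hN1 : (0 : ℝ) < N - 1 := sub_pos.2 (by exact_mod_cast hN)
  have hKN : (0 : ℝ) < K * N := mul_pos (by exact_mod_cast hK) (by linarith)
  rw [add_comm, add_le_add_iff_left, div_le_iff₀ hKN, mul_comm (K - N : ℝ), mul_comm x,
    mul_assoc] at h
  linarith [le_of_mul_le_mul_left h hN1]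

end Ratio

end SecureCaching

theorem theorem3 (N K : ℕ) (hN : 2 ≤ N) (hK : 1 ≤ K) (M : ℝ)
    (hM : max (((K : ℝ) - N) * ((N : ℝ) - 1) / ((K : ℝ) * N) + 1) 1 ≤ M) (hMN : M ≤ N) :
    (∃ R : ℝ, SecureCaching.SecurelyAchievable N K M R) ∧
    (M < N →
      0 < SecureCaching.optimalRate N K M ∧
      1 ≤ SecureCaching.centralizedRate N K M / SecureCaching.optimalRate N K M ∧
      SecureCaching.centralizedRate N K M / SecureCaching.optimalRate N K M ≤ 17) ∧
    (M = N →
      SecureCaching.centralizedRate N K M = 0 ∧ SecureCaching.optimalRate N K M = 0) := by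
  open SecureCaching in
  obtain ⟨hMc, hM1⟩ := max_le_iff.1 hM
  refine ⟨exists_securelyAchievable hN hK hM1, fun hlt => ?_, ?_⟩
  · have hpos : 0 < optimalRate N K M := optimalRate_pos hN hK hM1 hlt
    refine ⟨hpos, (one_le_div hpos).2 (optimalRate_le_centralizedRate hN hK hM1 hMN),
      (div_le_iff₀ hpos).2 ?_⟩
    obtain ⟨x, hx0, hx1, rfl⟩ := exists_eq_one_add_mul_sub_one hN hM1 hMN
    have hxne : x ≠ 1 := by
      rintro rfl
      simp at hlt
    exact centralizedRate_le_seventeen_mul_optimalRate hN hK hx0 (hx1.lt_of_ne hxne)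
      (le_mul_one_add_mul_of_div_add_one_le hN hK hMc)
  · rintro rfl
    exact ⟨centralizedRate_self hN hK, optimalRate_self hN hK⟩
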